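/- Let $d\ge 1$ and $k\ge 0$ be integers. Let $V_+=\{x\in\mathbb R^d : 0\le x_1,\dots,x_d\le 1,\ \|x\|_1\le k\}$ and let $B_{\mathsf{count}}=\operatorname{conv}(V_+\cup -V_+)$ be the Count ball. For a sign vector $J\in\{-1,1\}^d$, let $O(J)=\{(J_1v_1,\dots,J_dv_d) : v_1,\dots,v_d\ge 0\}$ be the corresponding orthant, and let $T(J)=B_{\mathsf{count}}\cap O(J)$. For integers $n,m\ge 0$, let the Eulerian number $A_{n,m}$ be the number of permutations $\sigma$ of $\{1,\dots,n\}$ with exactly $m$ ascents, i.e. exactly $m$ positions $1\le i<n$ with $\sigma(i)<\sigma(i+1)$ (so $A_{0,0}=1$). If exactly $j$ coordinates of $J$ equal $1$, then the $d$-dimensional Lebesgue measure of $T(J)$ is $$|T(J)|=\Bigl(\sum_{i=1}^{k}A_{j,i-1}\Bigr)\Bigl(\sum_{i=1}^{k}A_{d-j,i-1}\Bigr)\frac{1}{d!}.$$ -/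

import Mathlib

/-- The ascent positions of a permutation `σ` of `n` elements: the positions `i` that have a
successor position `i + 1` and satisfy `σ i < σ (i + 1)`. -/
def ascents {n : ℕ} (σ : Equiv.Perm (Fin n)) : Finset (Fin n) :=
  Finset.univ.filter fun i => ∃ h : (i : ℕ) + 1 < n, σ i < σ ⟨(i : ℕ) + 1, h⟩

/-- The Eulerian number `A_{n,m}`: the number of permutations of `n` elements with exactly
`m` ascents. -/
def eulerianNumber (n m : ℕ) : ℕ :=
  (Finset.univ.filter fun σ : Equiv.Perm (Fin n) => (ascents σ).card = m).card

/-- `V₊ = {x ∈ ℝ^d | 0 ≤ x₁, …, x_d ≤ 1 and ‖x‖₁ ≤ k}`. -/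
def countPositivePart (d k : ℕ) : Set (Fin d → ℝ) :=
  {x | (∀ i, 0 ≤ x i ∧ x i ≤ 1) ∧ ∑ i, |x i| ≤ (k : ℝ)}

/-- The Count ball: the convex hull of `V₊ ∪ -V₊`. -/
def countBall (d k : ℕ) : Set (Fin d → ℝ) :=
  convexHull ℝ (countPositivePart d k ∪ {x | -x ∈ countPositivePart d k})

/-- The orthant `O(J)`: all coordinatewise products `J * v` where `v` has nonnegative
coordinates. -/
def orthant {d : ℕ} (J : Fin d → ℝ) : Set (Fin d → ℝ) :=
  {x | ∃ v : Fin d → ℝ, (∀ i, 0 ≤ v i) ∧ x = J * v}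

/-- `T(J)`: the part of the Count ball in the orthant `O(J)`. -/
def countBallInOrthant {d : ℕ} (k : ℕ) (J : Fin d → ℝ) : Set (Fin d → ℝ) :=
  countBall d k ∩ orthant J

/-! The reflection `x ↦ J * x` carries $T(J)$ into the nonnegative orthant. There a convex
combination $au-bw$ with $u,w\in V_+$ splits into the block $J_i=1$, bounded by $au$, and the block
$J_i=-1$, bounded by $bw$. With $N(v)=\max(\|v\|_\infty,\|v\|_1/k)$ the reflected set is therefore
$\{v\ge 0: N(v_+)+N(v_-)\le 1\}$ (`sign_mul_mem_countBallInOrthant`).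

For $p\ge 0$ homogeneous of degree 1, $\int e^{-p}=n!\,|\{p\le 1\}|$ over the orthant. As
$e^{-(p+q)}$ factors, $d!\,|T(J)|$ is the product of $n!\,|\{N\le 1\}|$ over the two blocks
(`factorial_mul_orthantMeasure_blockNorm`).

Each factor is $n!$ times the volume of the cube slice $\sum x_i\le k$. Stanley's measure-preserving
map `fractDiff` sends almost every point with the order type of $\sigma$ to one whose coordinate sum
lies strictly between $\mathrm{asc}(\sigma)$ and $\mathrm{asc}(\sigma)+1$ (for $n\ge 1$), so the
slice counts permutations with fewer than $k$ ascents (`factorial_mul_cubeMeasure_sum_le`). -/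

open MeasureTheory
open scoped Pointwise

/-! ### Volumes of sublevel sets as exponential integrals -/

/-- If the sublevel sets of `p` have the measure `μ {p ≤ t} = t ^ n * V`, then
`∫ exp (-p) = n! * V`. -/
lemma lintegral_exp_neg_of_measure_sublevel {α : Type*} [MeasurableSpace α] (μ : Measure α)
    [SFinite μ] {p : α → ℝ} (hp : Measurable p) (hp0 : ∀ x, 0 ≤ p x) (n : ℕ) (V : ENNReal)
    (h : ∀ t : ℝ, 0 < t → μ {x | p x ≤ t} = ENNReal.ofReal (t ^ n) * V) :
    ∫⁻ x, ENNReal.ofReal (Real.exp (-p x)) ∂μ = (n.factorial : ENNReal) * V := by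
  -- Layer cake: $e^{-p}=\int_p^\infty e^{-t}\,dt$; after Tonelli the remaining integral is
  -- $\Gamma(n+1)\,V$.
  have h1 : ∀ x, ENNReal.ofReal (Real.exp (-p x)) =
      ∫⁻ t in Set.Ioi (0 : ℝ), {q : α × ℝ | p q.1 ≤ q.2}.indicator
        (fun q => ENNReal.ofReal (Real.exp (-q.2))) (x, t) := by
    intro x
    have h2 : ∀ t, {q : α × ℝ | p q.1 ≤ q.2}.indicator
        (fun q => ENNReal.ofReal (Real.exp (-q.2))) (x, t) =
        (Set.Ici (p x)).indicator (fun t => ENNReal.ofReal (Real.exp (-t))) t := by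
      intro t
      simp [Set.indicator_apply]
    simp_rw [h2]
    rw [setLIntegral_indicator measurableSet_Ici]
    have h3 : (Set.Ici (p x) ∩ Set.Ioi 0 : Set ℝ) =ᵐ[volume] Set.Ioi (p x) := by
      have e1 : (Set.Ici (p x) : Set ℝ) =ᵐ[volume] Set.Ioi (p x) := Ioi_ae_eq_Ici.symm
      refine (e1.inter (Filter.EventuallyEq.refl _ _)).trans ?_
      rw [Set.Ioi_inter_Ioi, max_eq_left (hp0 x)]
      exact Filter.EventuallyEq.rfl
    rw [setLIntegral_congr h3, ← ofReal_integral_eq_lintegral_ofReal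
      (integrableOn_exp_neg_Ioi _) (Filter.Eventually.of_forall fun t => (Real.exp_pos _).le),
      integral_exp_neg_Ioi]
  simp_rw [h1]
  have hm : MeasurableSet {q : α × ℝ | p q.1 ≤ q.2} :=
    measurableSet_le (hp.comp measurable_fst) measurable_snd
  rw [lintegral_lintegral_swap]
  · have h4 : ∀ t ∈ Set.Ioi (0 : ℝ), ∫⁻ x, {q : α × ℝ | p q.1 ≤ q.2}.indicator
        (fun q => ENNReal.ofReal (Real.exp (-q.2))) (x, t) ∂μ =
        ENNReal.ofReal (Real.exp (-t) * t ^ ((n + 1 : ℝ) - 1)) * V := by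
      intro t ht
      have h5 : ∀ x, {q : α × ℝ | p q.1 ≤ q.2}.indicator
          (fun q => ENNReal.ofReal (Real.exp (-q.2))) (x, t) =
          {x | p x ≤ t}.indicator (fun _ => ENNReal.ofReal (Real.exp (-t))) x := by
        intro x
        simp [Set.indicator_apply]
      simp_rw [h5]
      rw [lintegral_indicator_const (measurableSet_le hp measurable_const), h t ht,
        ENNReal.ofReal_mul (Real.exp_pos _).le, add_sub_cancel_right, Real.rpow_natCast, mul_assoc]
    rw [setLIntegral_congr_fun measurableSet_Ioi h4, lintegral_mul_const]
    · rw [← ofReal_integral_eq_lintegral_ofReal (Real.GammaIntegral_convergent (by positivity)),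
        ← Real.Gamma_eq_integral (by positivity), Real.Gamma_nat_eq_factorial,
        ENNReal.ofReal_natCast]
      filter_upwards [ae_restrict_mem measurableSet_Ioi] with t ht
      have : (0 : ℝ) < t := ht
      positivity
    · fun_prop
  · refine Measurable.aemeasurable ?_
    change Measurable ({q : α × ℝ | p q.1 ≤ q.2}.indicator
        (fun q => ENNReal.ofReal (Real.exp (-q.2))))
    exact Measurable.indicator (by fun_prop) hm

/-! ### Stanley's measure-preserving map of the cube -/

/-- The first coordinate of a vector, and `0` for the empty vector. -/
noncomputable def headOrZero {n : ℕ} (x : Fin n → ℝ) : ℝ :=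
  if h : 0 < n then x ⟨0, h⟩ else 0

/-- The coordinate after the `i`-th one, and `0` after the last one. -/
noncomputable def nextOrZero {n : ℕ} (x : Fin n → ℝ) (i : Fin n) : ℝ :=
  if h : (i : ℕ) + 1 < n then x ⟨(i : ℕ) + 1, h⟩ else 0

/-- The map `x ↦ (fract (xᵢ - xᵢ₊₁))ᵢ`. -/
noncomputable def fractDiff {n : ℕ} (x : Fin n → ℝ) : Fin n → ℝ :=
  fun i => Int.fract (x i - nextOrZero x i)

lemma nextOrZero_zero {n : ℕ} (x : Fin (n + 1) → ℝ) :
    nextOrZero x 0 = headOrZero (Fin.tail x) := by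
  unfold nextOrZero headOrZero
  by_cases h : 0 < n
  · simp [h, Fin.tail]
  · simp [h]

lemma nextOrZero_succ {n : ℕ} (x : Fin (n + 1) → ℝ) (i : Fin n) :
    nextOrZero x i.succ = nextOrZero (Fin.tail x) i := by
  unfold nextOrZero
  by_cases h : (i : ℕ) + 1 < n
  · simp [h, Fin.tail]
  · simp [h]

lemma sum_sub_nextOrZero {n : ℕ} (x : Fin n → ℝ) :
    ∑ i, (x i - nextOrZero x i) = headOrZero x := by
  induction n with
  | zero => simp [headOrZero]
  | succ n ih =>
    rw [Fin.sum_univ_succ, nextOrZero_zero]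
    simp_rw [nextOrZero_succ]
    rw [show ∑ i : Fin n, (x i.succ - nextOrZero (Fin.tail x) i) = headOrZero (Fin.tail x) from
      ih (Fin.tail x)]
    simp [headOrZero]

lemma measurable_headOrZero (n : ℕ) : Measurable (headOrZero : (Fin n → ℝ) → ℝ) := by
  unfold headOrZero
  by_cases h : 0 < n
  · simp only [h, dite_true]
    fun_prop
  · simp only [h, dite_false]
    fun_prop

lemma restrict_Icc_eq_restrict_Ioc : (volume.restrict (Set.Icc (0 : ℝ) 1)) =
    volume.restrict (Set.Ioc 0 1) := Measure.restrict_congr_set Ioc_ae_eq_Icc.symm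

/-- A rotation of the circle: the preimage of a set under `Int.fract` is 1-periodic, so its trace on
every interval of length 1 has the same measure. Endpoints are null. -/
lemma measurePreserving_fract_sub (c : ℝ) :
    MeasurePreserving (fun x : ℝ => Int.fract (x - c)) (volume.restrict (Set.Icc 0 1))
      (volume.restrict (Set.Icc 0 1)) := by
  refine ⟨by fun_prop, ?_⟩
  ext s hs
  have hA : MeasurableSet ((Int.fract : ℝ → ℝ) ⁻¹' s) := measurable_fract hs
  rw [Measure.map_apply (by fun_prop) hs, restrict_Icc_eq_restrict_Ioc, Measure.restrict_apply
    (by exact (measurable_fract.comp (measurable_id.sub_const c)) hs)]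
  have h1 : ((fun x : ℝ => Int.fract (x - c)) ⁻¹' s ∩ Set.Ioc 0 1) =
      (fun x => x - c) ⁻¹' (Int.fract ⁻¹' s ∩ Set.Ioc (-c) (-c + 1)) := by
    ext x
    simp only [Set.mem_inter_iff, Set.mem_preimage, Set.mem_Ioc]
    refine and_congr_right fun _ => ?_
    constructor <;> rintro ⟨h, h'⟩ <;> constructor <;> linarith
  rw [h1, (measurePreserving_sub_right volume c).measure_preimage
    (hA.inter measurableSet_Ioc).nullMeasurableSet]
  have h2 := (isAddFundamentalDomain_Ioc (T := 1) one_pos (-c) volume).measure_set_eq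
    (isAddFundamentalDomain_Ioc (T := 1) one_pos 0 volume) hA (by
      rintro ⟨g, hg⟩
      obtain ⟨z, rfl⟩ := AddSubgroup.mem_zmultiples_iff.1 hg
      ext x
      have : Int.fract ((z : ℝ) + x) = Int.fract x := by
        rw [add_comm]
        exact Int.fract_add_intCast x z
      simp [AddSubgroup.vadd_def, this])
  rw [h2, zero_add]
  have h3 : (Int.fract ⁻¹' s ∩ Set.Ioo 0 1 : Set ℝ) = s ∩ Set.Ioo 0 1 := by
    ext x
    refine and_congr_left fun hx => ?_
    rw [Set.mem_preimage, Int.fract_eq_self.2 ⟨hx.1.le, hx.2⟩]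
  have h4 : ∀ A : Set ℝ, volume (A ∩ Set.Ioc 0 1) = volume (A ∩ Set.Ioo 0 1) := fun A =>
    measure_congr ((Filter.EventuallyEq.refl _ A).inter Ioo_ae_eq_Ioc.symm)
  rw [h4, h3, ← h4, Measure.restrict_apply hs]

/-- The uniform measure on the unit cube of dimension `n`. -/
noncomputable abbrev cubeMeasure (n : ℕ) : Measure (Fin n → ℝ) :=
  Measure.pi fun _ => volume.restrict (Set.Icc (0 : ℝ) 1)

lemma cubeMeasure_eq_restrict (n : ℕ) :
    cubeMeasure n = volume.restrict (Set.univ.pi fun _ => Set.Icc (0 : ℝ) 1) :=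
  (Measure.restrict_pi_pi (fun _ : Fin n => (volume : Measure ℝ)) _).symm

instance isProbabilityMeasure_restrict_Icc :
    IsProbabilityMeasure (volume.restrict (Set.Icc (0 : ℝ) 1)) := ⟨by simp⟩

/-- The map is triangular: for a fixed tail, the first coordinate undergoes a rotation. Induction
applies through a skew product, whose base is the tail; hence the swaps. -/
lemma measurePreserving_fractDiff (n : ℕ) :
    MeasurePreserving (fractDiff : (Fin n → ℝ) → Fin n → ℝ) (cubeMeasure n) (cubeMeasure n) := by
  induction n with
  | zero =>
    convert MeasurePreserving.id (cubeMeasure 0)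
  | succ n ih =>
    have e : MeasurePreserving (MeasurableEquiv.piFinSuccAbove (fun _ : Fin (n + 1) => ℝ) 0)
        (cubeMeasure (n + 1)) ((volume.restrict (Set.Icc (0 : ℝ) 1)).prod (cubeMeasure n)) :=
      measurePreserving_piFinSuccAbove
        (fun _ : Fin (n + 1) => volume.restrict (Set.Icc (0 : ℝ) 1)) 0
    have hs := ih.skew_product (μc := volume.restrict (Set.Icc (0 : ℝ) 1))
      (μd := volume.restrict (Set.Icc (0 : ℝ) 1))
      (g := fun r x => Int.fract (x - headOrZero r))
      (measurable_fract.comp (measurable_snd.sub ((measurable_headOrZero n).comp measurable_fst)))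
      (Filter.Eventually.of_forall fun r => (measurePreserving_fract_sub (headOrZero r)).map_eq)
    have := e.symm.comp (Measure.measurePreserving_swap.comp
      (hs.comp (Measure.measurePreserving_swap.comp e)))
    convert this using 1
    ext x i
    refine Fin.cases ?_ (fun i => ?_) i
    · simp [fractDiff, nextOrZero_zero, MeasurableEquiv.piFinSuccAbove, Fin.insertNthEquiv]
    · simp [fractDiff, nextOrZero_succ, MeasurableEquiv.piFinSuccAbove, Fin.insertNthEquiv]
      rfl

/-! ### Order types of points and slices of the cube -/

/-- The vectors whose coordinates are in the same relative order as the values of `σ`. -/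
def orderRegion {n : ℕ} (σ : Equiv.Perm (Fin n)) : Set (Fin n → ℝ) :=
  {x | ∀ i j, x i < x j ↔ σ i < σ j}

lemma measurableSet_orderRegion {n : ℕ} (σ : Equiv.Perm (Fin n)) :
    MeasurableSet (orderRegion σ) := by
  have : orderRegion σ = ⋂ i, ⋂ j, {x | x i < x j ↔ σ i < σ j} := by
    ext; simp [orderRegion]
  rw [this]
  refine MeasurableSet.iInter fun i => MeasurableSet.iInter fun j => ?_
  by_cases h : σ i < σ j
  · simp only [h, iff_true]
    exact measurableSet_lt (measurable_pi_apply i) (measurable_pi_apply j)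
  · simp only [h, iff_false, not_lt]
    exact measurableSet_le (measurable_pi_apply j) (measurable_pi_apply i)

lemma cubeMeasure_orderRegion_eq {n : ℕ} (σ : Equiv.Perm (Fin n)) :
    cubeMeasure n (orderRegion σ) = cubeMeasure n (orderRegion (1 : Equiv.Perm (Fin n))) := by
  have h := measurePreserving_piCongrLeft
    (fun _ : Fin n => volume.restrict (Set.Icc (0 : ℝ) 1)) σ
  rw [← h.measure_preimage (measurableSet_orderRegion 1).nullMeasurableSet]
  congr 1
  ext x
  have hx : ∀ i, MeasurableEquiv.piCongrLeft (fun _ : Fin n => ℝ) σ x (σ i) = x i := fun i =>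
    Equiv.piCongrLeft_apply_apply (fun _ : Fin n => ℝ) σ x i
  simp only [orderRegion, Set.mem_ofPred_eq, Set.mem_preimage, Equiv.Perm.one_apply]
  constructor
  · intro H a b
    obtain ⟨i, rfl⟩ := σ.surjective a
    obtain ⟨j, rfl⟩ := σ.surjective b
    rw [hx, hx, H]
  · intro H i j
    rw [← H, hx, hx]

lemma pairwise_disjoint_orderRegion (n : ℕ) :
    Pairwise (Function.onFun Disjoint (orderRegion : Equiv.Perm (Fin n) → Set (Fin n → ℝ))) := by
  intro σ τ hne
  refine Set.disjoint_left.2 fun x hσ hτ => hne ?_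
  have h : ∀ i j, σ i < σ j ↔ τ i < τ j := fun i j => (hσ i j).symm.trans (hτ i j)
  -- Permutations inducing the same order differ by an order automorphism of `Fin n`, which is the
  -- identity.
  have hm : StrictMono (τ ∘ σ.symm) := fun a b hab => by
    simpa using (h (σ.symm a) (σ.symm b)).1 (by simpa using hab)
  have hid : (τ ∘ σ.symm : Fin n → Fin n) = id :=
    ((hm.range_inj strictMono_id).1 (by
      rw [Set.range_id, (τ.surjective.comp σ.symm.surjective).range_eq]))
  ext i
  have := congrFun hid (σ i)
  simp only [Function.comp_apply, Equiv.symm_apply_apply, id] at this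
  rw [this]

lemma exists_mem_orderRegion {n : ℕ} {x : Fin n → ℝ} (hx : Function.Injective x) :
    ∃ σ, x ∈ orderRegion σ := by
  refine ⟨(Tuple.sort x).symm, fun i j => ?_⟩
  have hm : StrictMono (x ∘ Tuple.sort x) :=
    (Tuple.monotone_sort x).strictMono_of_injective (hx.comp (Tuple.sort x).injective)
  have := hm.lt_iff_lt (a := (Tuple.sort x).symm i) (b := (Tuple.sort x).symm j)
  simpa using this

lemma volume_setOf_apply_eq {n : ℕ} {i j : Fin n} (h : i ≠ j) :
    volume {x : Fin n → ℝ | x i = x j} = 0 := by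
  have := Measure.addHaar_submodule (volume : Measure (Fin n → ℝ))
    (LinearMap.ker (LinearMap.proj (R := ℝ) (φ := fun _ : Fin n => ℝ) i - LinearMap.proj j)) (by
      intro htop
      have hm : (Pi.single i 1 : Fin n → ℝ) ∈ (⊤ : Submodule ℝ (Fin n → ℝ)) := trivial
      rw [← htop] at hm
      simp [h.symm] at hm)
  convert this using 2
  ext x
  simp [sub_eq_zero]

lemma ae_injective_cubeMeasure (n : ℕ) : ∀ᵐ x ∂cubeMeasure n, Function.Injective x := by
  have h : ∀ᵐ x ∂cubeMeasure n, ∀ i j, i ≠ j → x i ≠ x j := by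
    refine ae_all_iff.2 fun i => ae_all_iff.2 fun j => ?_
    by_cases hij : i = j
    · simp [hij]
    · rw [cubeMeasure_eq_restrict]
      refine ae_restrict_of_ae ?_
      have := volume_setOf_apply_eq hij
      rw [measure_eq_zero_iff_ae_notMem] at this
      filter_upwards [this] with x hx _ using hx
  filter_upwards [h] with x hx i j hij
  by_contra hne
  exact hx i j hne hij

lemma cubeMeasure_biUnion_orderRegion {n : ℕ} (s : Finset (Equiv.Perm (Fin n))) :
    cubeMeasure n (⋃ σ ∈ s, orderRegion σ) =
      s.card * cubeMeasure n (orderRegion (1 : Equiv.Perm (Fin n))) := by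
  rw [measure_biUnion_finset ((pairwise_disjoint_orderRegion n).set_pairwise _)
    fun σ _ => measurableSet_orderRegion σ]
  simp [cubeMeasure_orderRegion_eq]

lemma factorial_mul_cubeMeasure_orderRegion (n : ℕ) :
    (n.factorial : ENNReal) * cubeMeasure n (orderRegion (1 : Equiv.Perm (Fin n))) = 1 := by
  have h := cubeMeasure_biUnion_orderRegion (n := n) Finset.univ
  rw [Finset.card_univ, Fintype.card_perm, Fintype.card_fin] at h
  rw [← h, ← measure_univ (μ := cubeMeasure n)]
  refine measure_congr ?_
  filter_upwards [ae_injective_cubeMeasure n] with x hx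
  refine propext ⟨fun _ => trivial, fun _ => ?_⟩
  obtain ⟨σ, hσ⟩ := exists_mem_orderRegion hx
  exact Set.mem_biUnion (Finset.mem_univ σ) hσ

lemma sum_eulerianNumber (n k : ℕ) :
    ∑ i ∈ Finset.Icc 1 k, eulerianNumber n (i - 1) =
      (Finset.univ.filter fun σ : Equiv.Perm (Fin n) => (ascents σ).card < k).card := by
  -- Fibres of the ascent count plus one, to match the index $i-1$ with $i\ge 1$.
  rw [Finset.card_eq_sum_card_fiberwise (f := fun σ => (ascents σ).card + 1) (t := Finset.Icc 1 k)]
  · refine Finset.sum_congr rfl fun i hi => ?_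
    rw [Finset.mem_Icc] at hi
    unfold eulerianNumber
    congr 1
    ext σ
    simp only [Finset.mem_filter, Finset.mem_univ, true_and]
    omega
  · intro σ hσ
    simp at hσ ⊢
    omega

lemma ae_mem_Ioo_cubeMeasure (n : ℕ) : ∀ᵐ x ∂cubeMeasure n, ∀ i, x i ∈ Set.Ioo (0 : ℝ) 1 := by
  refine ae_all_iff.2 fun i => ?_
  refine Measure.tendsto_eval_ae_ae (i := i) ?_
  change ∀ᵐ t ∂volume.restrict (Set.Icc (0 : ℝ) 1), t ∈ Set.Ioo (0 : ℝ) 1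
  rw [Measure.restrict_congr_set Ioo_ae_eq_Icc.symm]
  exact ae_restrict_mem measurableSet_Ioo

/-- Each difference lies in $(-1,1)$ and, off the last position, is negative exactly at an ascent,
where `Int.fract` adds 1. The rest telescopes. -/
lemma sum_fractDiff {n : ℕ} {σ : Equiv.Perm (Fin n)} {x : Fin n → ℝ} (hx : x ∈ orderRegion σ)
    (h01 : ∀ i, x i ∈ Set.Ioo (0 : ℝ) 1) :
    ∑ i, fractDiff x i = headOrZero x + (ascents σ).card := by
  have h : ∀ i, fractDiff x i = (x i - nextOrZero x i) + if i ∈ ascents σ then 1 else 0 := by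
    intro i
    have hi := h01 i
    unfold fractDiff nextOrZero
    by_cases hn : (i : ℕ) + 1 < n
    · have hi' := h01 ⟨(i : ℕ) + 1, hn⟩
      have hiff := hx i ⟨(i : ℕ) + 1, hn⟩
      simp only [ascents, Finset.mem_filter, Finset.mem_univ, true_and, hn, dite_true,
        exists_true_left]
      split_ifs with hlt <;> rw [← hiff] at hlt
      · rw [Int.fract_eq_iff]
        refine ⟨by linarith [hi.1, hi'.2], by linarith, -1, by push_cast; ring⟩
      · rw [Int.fract_eq_iff]
        refine ⟨by linarith [hi.1, hi'.2], by linarith [hi.2, hi'.1], 0, by push_cast; ring⟩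
    · simp only [ascents, Finset.mem_filter, Finset.mem_univ, true_and, hn, dite_false,
        IsEmpty.exists_iff, if_false, add_zero, sub_zero]
      exact Int.fract_eq_self.2 ⟨hi.1.le, hi.2⟩
  simp_rw [h]
  rw [Finset.sum_add_distrib, sum_sub_nextOrZero]
  simp

/-- The volume of the cube below a hyperplane `∑ xᵢ = k` in terms of Eulerian numbers. -/
theorem factorial_mul_cubeMeasure_sum_le (n : ℕ) {k : ℕ} (hk : 1 ≤ k) :
    (n.factorial : ENNReal) * cubeMeasure n {x | ∑ i, x i ≤ (k : ℝ)} =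
      ((∑ i ∈ Finset.Icc 1 k, eulerianNumber n (i - 1) : ℕ) : ENNReal) := by
  have hm : MeasurableSet {x : Fin n → ℝ | ∑ i, x i ≤ (k : ℝ)} :=
    measurableSet_le (by fun_prop) measurable_const
  have hae : cubeMeasure n {x | ∑ i, x i ≤ (k : ℝ)} = cubeMeasure n
      (⋃ σ ∈ Finset.univ.filter fun σ : Equiv.Perm (Fin n) => (ascents σ).card < k,
        orderRegion σ) := by
    rw [← (measurePreserving_fractDiff n).measure_preimage hm.nullMeasurableSet]
    refine measure_congr ?_
    filter_upwards [ae_injective_cubeMeasure n, ae_mem_Ioo_cubeMeasure n] with x hx h01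
    obtain ⟨σ, hσ⟩ := exists_mem_orderRegion hx
    have hle : (∑ i, fractDiff x i ≤ (k : ℝ)) ↔ (ascents σ).card < k := by
      rw [sum_fractDiff hσ h01]
      -- For $n=0$ both sides hold because $k\ge 1$; otherwise $0<x_0<1$ rounds the inequality to a
      -- strict one between integers.
      rcases Nat.eq_zero_or_pos n with rfl | hn
      · simp [headOrZero, ascents]
        omega
      · have h0 := h01 ⟨0, hn⟩
        simp only [headOrZero, hn, dite_true]
        constructor
        · intro h
          have : ((ascents σ).card : ℝ) < k := by linarith [h0.1]
          exact_mod_cast this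
        · intro h
          have : ((ascents σ).card : ℝ) + 1 ≤ k := by exact_mod_cast h
          linarith [h0.2]
    refine propext (hle.trans ⟨fun h => ?_, fun h => ?_⟩)
    · exact Set.mem_biUnion (show σ ∈ _ by simpa using h) hσ
    · obtain ⟨τ, hτ, hxτ⟩ := Set.mem_iUnion₂.1 h
      have : τ = σ := by
        by_contra hne
        exact Set.disjoint_left.1 (pairwise_disjoint_orderRegion n hne) hxτ hσ
      subst this
      simpa using hτ
  rw [hae, cubeMeasure_biUnion_orderRegion, sum_eulerianNumber, mul_left_comm,
    factorial_mul_cubeMeasure_orderRegion, mul_one]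

/-! ### The norm $N$ and its unit ball in the orthant -/

/-- The norm whose unit ball has `countPositivePart` as its nonnegative part. -/
noncomputable def countNorm {ι : Type*} [Fintype ι] (k : ℕ) (x : ι → ℝ) : ℝ :=
  max ‖x‖ ((∑ i, |x i|) / k)

section CountNorm

variable {ι : Type*} [Fintype ι] {k : ℕ}

lemma countNorm_nonneg (x : ι → ℝ) : 0 ≤ countNorm k x :=
  le_max_of_le_left (norm_nonneg x)

lemma measurable_countNorm : Measurable (countNorm k : (ι → ℝ) → ℝ) := by
  unfold countNorm
  fun_prop

lemma measurable_exp_neg_countNorm :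
    Measurable fun x : ι → ℝ => ENNReal.ofReal (Real.exp (-countNorm k x)) :=
  measurable_countNorm.neg.exp.ennreal_ofReal

lemma countNorm_smul {c : ℝ} (hc : 0 ≤ c) (x : ι → ℝ) :
    countNorm k (c • x) = c * countNorm k x := by
  unfold countNorm
  rw [norm_smul, Real.norm_of_nonneg hc, mul_max_of_nonneg _ _ hc]
  simp [abs_mul, abs_of_nonneg hc, ← Finset.mul_sum, mul_div_assoc]

lemma countNorm_le_iff (hk : 1 ≤ k) {t : ℝ} (ht : 0 ≤ t) {x : ι → ℝ} (hx : ∀ i, 0 ≤ x i) :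
    countNorm k x ≤ t ↔ (∀ i, x i ≤ t) ∧ ∑ i, x i ≤ t * k := by
  have hk' : (0 : ℝ) < k := by exact_mod_cast hk
  unfold countNorm
  rw [max_le_iff, pi_norm_le_iff_of_nonneg ht, div_le_iff₀ hk']
  simp [abs_of_nonneg (hx _)]

end CountNorm

/-- Lebesgue measure on the nonnegative orthant. -/
noncomputable abbrev orthantMeasure (ι : Type*) [Fintype ι] : Measure (ι → ℝ) :=
  volume.restrict (Set.Ici 0)

/-- Sublevel sets of a positively homogeneous function scale with the dimension. -/
lemma orthantMeasure_sublevel {ι : Type*} [Fintype ι] {p : (ι → ℝ) → ℝ} (hp : Measurable p)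
    (hs : ∀ c : ℝ, 0 ≤ c → ∀ x, p (c • x) = c * p x) {t : ℝ} (ht : 0 < t) :
    orthantMeasure ι {x | p x ≤ t} =
      ENNReal.ofReal (t ^ Fintype.card ι) * orthantMeasure ι {x | p x ≤ 1} := by
  have hm : ∀ t : ℝ, MeasurableSet {x | p x ≤ t} := fun t => measurableSet_le hp measurable_const
  rw [Measure.restrict_apply (hm t), Measure.restrict_apply (hm 1)]
  have h : ({x | p x ≤ t} ∩ Set.Ici 0 : Set (ι → ℝ)) = t • ({x | p x ≤ 1} ∩ Set.Ici 0) := by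
    ext x
    rw [Set.mem_smul_set_iff_inv_smul_mem₀ ht.ne']
    simp only [Set.mem_inter_iff, Set.mem_ofPred_eq, Set.mem_Ici, hs _ (inv_nonneg.2 ht.le)]
    refine and_congr ?_ ?_
    · rw [inv_mul_le_iff₀ ht, mul_one]
    · refine ⟨fun h => smul_nonneg (inv_nonneg.2 ht.le) h, fun h => ?_⟩
      simpa [smul_smul, ht.ne'] using smul_nonneg ht.le h
  rw [h, Measure.addHaar_smul, Module.finrank_fintype_fun_eq_card, abs_of_pos (by positivity)]

/-- The integral of `exp (-p)` over the nonnegative orthant is `n!` times the volume of the unit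
ball of `p` there. -/
lemma lintegral_exp_neg_orthantMeasure {ι : Type*} [Fintype ι] {p : (ι → ℝ) → ℝ}
    (hp : Measurable p) (hp0 : ∀ x, 0 ≤ p x)
    (hs : ∀ c : ℝ, 0 ≤ c → ∀ x, p (c • x) = c * p x) :
    ∫⁻ x, ENNReal.ofReal (Real.exp (-p x)) ∂orthantMeasure ι =
      ((Fintype.card ι).factorial : ENNReal) * orthantMeasure ι {x | p x ≤ 1} :=
  lintegral_exp_neg_of_measure_sublevel _ hp hp0 _ _ fun _ ht => orthantMeasure_sublevel hp hs ht

lemma orthantMeasure_countNorm_fin (n : ℕ) {k : ℕ} (hk : 1 ≤ k) :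
    orthantMeasure (Fin n) {x | countNorm k x ≤ 1} = cubeMeasure n {x | ∑ i, x i ≤ (k : ℝ)} := by
  rw [cubeMeasure_eq_restrict,
    Measure.restrict_apply (measurableSet_le measurable_countNorm measurable_const),
    Measure.restrict_apply (measurableSet_le (by fun_prop) measurable_const)]
  congr 1
  ext x
  simp only [Set.mem_inter_iff, Set.mem_ofPred_eq, Set.mem_Ici, Set.mem_univ_pi, Set.mem_Icc]
  constructor
  · rintro ⟨h, h0⟩
    have := (countNorm_le_iff hk zero_le_one h0).1 h
    exact ⟨by linarith [this.2], fun i => ⟨h0 i, this.1 i⟩⟩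
  · rintro ⟨h, h01⟩
    have h0 : ∀ i, 0 ≤ x i := fun i => (h01 i).1
    exact ⟨(countNorm_le_iff hk zero_le_one h0).2 ⟨fun i => (h01 i).2, by linarith⟩, h0⟩

lemma orthantMeasure_countNorm_congr {ι κ : Type*} [Fintype ι] [Fintype κ] (e : ι ≃ κ) (k : ℕ) :
    orthantMeasure ι {x | countNorm k x ≤ 1} = orthantMeasure κ {x | countNorm k x ≤ 1} := by
  have h := volume_measurePreserving_piCongrLeft (fun _ : κ => ℝ) e
  rw [Measure.restrict_apply (measurableSet_le measurable_countNorm measurable_const),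
    Measure.restrict_apply (measurableSet_le measurable_countNorm measurable_const),
    ← h.measure_preimage ((measurableSet_le measurable_countNorm measurable_const).inter
      measurableSet_Ici).nullMeasurableSet]
  congr 1
  ext x
  have hx : ∀ i, MeasurableEquiv.piCongrLeft (fun _ : κ => ℝ) e x (e i) = x i := fun i =>
    Equiv.piCongrLeft_apply_apply (fun _ : κ => ℝ) e x i
  have hn : countNorm k (MeasurableEquiv.piCongrLeft (fun _ : κ => ℝ) e x) = countNorm k x := by
    unfold countNorm
    congr 1
    · refine le_antisymm ((pi_norm_le_iff_of_nonneg (norm_nonneg _)).2 fun j => ?_)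
        ((pi_norm_le_iff_of_nonneg (norm_nonneg _)).2 fun i => ?_)
      · obtain ⟨i, rfl⟩ := e.surjective j
        rw [hx]
        exact norm_le_pi_norm x i
      · rw [← hx]
        exact norm_le_pi_norm _ (e i)
    · rw [← e.sum_comp]
      simp_rw [hx]
  simp only [Set.mem_inter_iff, Set.mem_preimage, Set.mem_ofPred_eq, Set.mem_Ici, hn,
    Pi.le_def, Pi.zero_apply]
  refine and_congr_right fun _ => ?_
  rw [← e.forall_congr_right]
  simp_rw [hx]

/-- `n!` times the volume of the nonnegative part of the unit ball is a sum of Eulerian numbers. -/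
lemma factorial_mul_orthantMeasure_countNorm (ι : Type*) [Fintype ι] {k : ℕ} (hk : 1 ≤ k) :
    ((Fintype.card ι).factorial : ENNReal) * orthantMeasure ι {x | countNorm k x ≤ 1} =
      ((∑ i ∈ Finset.Icc 1 k, eulerianNumber (Fintype.card ι) (i - 1) : ℕ) : ENNReal) := by
  rw [orthantMeasure_countNorm_congr (Fintype.equivFin ι), orthantMeasure_countNorm_fin _ hk,
    factorial_mul_cubeMeasure_sum_le _ hk]

/-! ### Volume of an ℓ¹-sum of two blocks -/

/-- The ℓ¹-sum of the count norms of the two blocks of coordinates given by `P`. -/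
noncomputable def blockNorm {ι : Type*} [Fintype ι] (P : ι → Prop) [DecidablePred P] (k : ℕ)
    (x : ι → ℝ) : ℝ :=
  countNorm k (fun i : {i // P i} => x i) + countNorm k (fun i : {i // ¬P i} => x i)

theorem factorial_mul_orthantMeasure_blockNorm {ι : Type*} [Fintype ι] (P : ι → Prop)
    [DecidablePred P] (k : ℕ) :
    ((Fintype.card ι).factorial : ENNReal) * orthantMeasure ι {x | blockNorm P k x ≤ 1} =
      (((Fintype.card {i // P i}).factorial : ENNReal) *
        orthantMeasure {i // P i} {x | countNorm k x ≤ 1}) *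
      (((Fintype.card {i // ¬P i}).factorial : ENNReal) *
        orthantMeasure {i // ¬P i} {x | countNorm k x ≤ 1}) := by
  have hb : Measurable (blockNorm P k) :=
    (measurable_countNorm.comp (by fun_prop)).add (measurable_countNorm.comp (by fun_prop))
  rw [← lintegral_exp_neg_orthantMeasure hb
      (fun x => add_nonneg (countNorm_nonneg _) (countNorm_nonneg _))
      (fun c hc x => by
        unfold blockNorm
        rw [mul_add, ← countNorm_smul hc, ← countNorm_smul hc]
        rfl),
    ← lintegral_exp_neg_orthantMeasure measurable_countNorm countNorm_nonneg
      (fun c hc x => countNorm_smul hc x),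
    ← lintegral_exp_neg_orthantMeasure measurable_countNorm countNorm_nonneg
      (fun c hc x => countNorm_smul hc x),
    ← lintegral_prod_mul measurable_exp_neg_countNorm.aemeasurable
      measurable_exp_neg_countNorm.aemeasurable, Measure.prod_restrict]
  have he := volume_preserving_piEquivPiSubtypeProd (fun _ : ι => ℝ) P
  have hr := he.restrict_preimage (s := Set.Ici 0 ×ˢ Set.Ici 0)
    (measurableSet_Ici.prod measurableSet_Ici)
  have hpre : MeasurableEquiv.piEquivPiSubtypeProd (fun _ : ι => ℝ) P ⁻¹'
      (Set.Ici 0 ×ˢ Set.Ici 0) = Set.Ici 0 := by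
    ext x
    simp only [Set.mem_preimage, Set.mem_prod, Set.mem_Ici, Pi.le_def]
    constructor
    · rintro ⟨h1, h2⟩ i
      by_cases hi : P i
      · exact h1 ⟨i, hi⟩
      · exact h2 ⟨i, hi⟩
    · exact fun h => ⟨fun i => h i, fun i => h i⟩
  rw [hpre] at hr
  change _ = ∫⁻ z, _ ∂(volume : Measure (({i // P i} → ℝ) × ({i // ¬P i} → ℝ))).restrict _
  rw [← hr.lintegral_comp_emb (MeasurableEquiv.measurableEmbedding _)]
  refine lintegral_congr fun x => ?_
  rw [← ENNReal.ofReal_mul (Real.exp_pos _).le, ← Real.exp_add]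
  congr 2
  unfold blockNorm
  rw [neg_add]
  rfl

/-! ### Points of the Count ball and block norms -/

lemma convex_countPositivePart (d k : ℕ) : Convex ℝ (countPositivePart d k) := by
  intro x hx y hy a b ha hb hab
  refine ⟨fun i => ?_, ?_⟩
  · have h1 := hx.1 i
    have h2 := hy.1 i
    simp only [Pi.add_apply, Pi.smul_apply, smul_eq_mul]
    constructor
    · exact add_nonneg (mul_nonneg ha h1.1) (mul_nonneg hb h2.1)
    · nlinarith
  · have h1 := hx.2
    have h2 := hy.2
    calc ∑ i, |(a • x + b • y) i| ≤ ∑ i, (a * |x i| + b * |y i|) := by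
          refine Finset.sum_le_sum fun i _ => (abs_add_le _ _).trans_eq ?_
          simp [abs_mul, abs_of_nonneg ha, abs_of_nonneg hb]
      _ = a * ∑ i, |x i| + b * ∑ i, |y i| := by
          rw [Finset.sum_add_distrib, Finset.mul_sum, Finset.mul_sum]
      _ ≤ a * k + b * k := by gcongr
      _ = k := by rw [← add_mul, hab, one_mul]

lemma zero_mem_countPositivePart (d k : ℕ) : (0 : Fin d → ℝ) ∈ countPositivePart d k :=
  ⟨fun i => by simp, by simp⟩

/-- A point of the Count ball is a convex combination of a point of `V₊` and a point of `-V₊`. -/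
lemma mem_countBall {d k : ℕ} {x : Fin d → ℝ} :
    x ∈ countBall d k ↔ ∃ u ∈ countPositivePart d k, ∃ w ∈ countPositivePart d k,
      ∃ a b : ℝ, 0 ≤ a ∧ 0 ≤ b ∧ a + b = 1 ∧ x = a • u - b • w := by
  have hneg : {x | -x ∈ countPositivePart d k} = -countPositivePart d k := rfl
  unfold countBall
  rw [hneg, (convex_countPositivePart d k).convexHull_union (convex_countPositivePart d k).neg
    ⟨0, zero_mem_countPositivePart d k⟩ ⟨0, by simpa using zero_mem_countPositivePart d k⟩,
    mem_convexJoin]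
  constructor
  · rintro ⟨u, hu, w, hw, a, b, ha, hb, hab, rfl⟩
    exact ⟨u, hu, -w, hw, a, b, ha, hb, hab, by simp⟩
  · rintro ⟨u, hu, w, hw, a, b, ha, hb, hab, rfl⟩
    exact ⟨u, hu, -w, by simpa using hw, a, b, ha, hb, hab, by simp [sub_eq_add_neg]⟩

lemma countNorm_subtype_le_iff {d k : ℕ} (hk : 1 ≤ k) (P : Fin d → Prop) [DecidablePred P] {t : ℝ}
    (ht : 0 ≤ t) {v : Fin d → ℝ} (hv : ∀ i, 0 ≤ v i) :
    countNorm k (fun i : {i // P i} => v i) ≤ t ↔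
      (∀ i, P i → v i ≤ t) ∧ ∑ i, (if P i then v i else 0) ≤ t * k := by
  rw [countNorm_le_iff (x := fun i : {i // P i} => v i) hk ht fun i => hv i,
    Subtype.forall, ← Finset.sum_filter, Finset.sum_subtype (Finset.univ.filter P) (p := P) (by simp)]

/-- A block of a nonnegative vector of count norm at most `t` is `t` times a point of `V₊`. -/
lemma exists_smul_eq_of_countNorm_le {d k : ℕ} (hk : 1 ≤ k) (P : Fin d → Prop) [DecidablePred P]
    {t : ℝ} (ht : 0 ≤ t) {v : Fin d → ℝ} (hv : ∀ i, 0 ≤ v i)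
    (h : countNorm k (fun i : {i // P i} => v i) ≤ t) :
    ∃ u ∈ countPositivePart d k, ∀ i, t * u i = if P i then v i else 0 := by
  rw [countNorm_subtype_le_iff hk P ht hv] at h
  -- For $t=0$ the block vanishes and $u=0$ serves; otherwise $u$ is the block divided by $t$.
  rcases ht.eq_or_lt with rfl | ht
  · refine ⟨0, zero_mem_countPositivePart d k, fun i => ?_⟩
    split_ifs with hi
    · simpa using le_antisymm (hv i) (h.1 i hi)
    · simp
  · have h0 : ∀ i, 0 ≤ (if P i then v i else 0) / t := fun i => by
      split_ifs
      · exact div_nonneg (hv i) ht.le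
      · simp
    refine ⟨fun i => (if P i then v i else 0) / t, ⟨fun i => ⟨h0 i, ?_⟩, ?_⟩, fun i => ?_⟩
    · rw [div_le_one ht]
      split_ifs with hi
      · exact h.1 i hi
      · exact ht.le
    · simp_rw [abs_of_nonneg (h0 _)]
      rw [← Finset.sum_div, div_le_iff₀ ht, mul_comm]
      exact h.2
    · rw [mul_div_cancel₀ _ ht.ne']

lemma countNorm_le_of_le_mul {d k : ℕ} (hk : 1 ≤ k) (P : Fin d → Prop) [DecidablePred P]
    {t : ℝ} (ht : 0 ≤ t) {v u : Fin d → ℝ} (hv : ∀ i, 0 ≤ v i) (hu : u ∈ countPositivePart d k)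
    (h : ∀ i, P i → v i ≤ t * u i) : countNorm k (fun i : {i // P i} => v i) ≤ t := by
  rw [countNorm_subtype_le_iff hk P ht hv]
  constructor
  · intro i hi
    exact (h i hi).trans (mul_le_of_le_one_right ht (hu.1 i).2)
  · calc ∑ i, (if P i then v i else 0) ≤ ∑ i, t * |u i| := by
          refine Finset.sum_le_sum fun i _ => ?_
          split_ifs with hi
          · exact (h i hi).trans (mul_le_mul_of_nonneg_left (le_abs_self _) ht)
          · positivity
      _ ≤ t * k := by
          rw [← Finset.mul_sum]
          exact mul_le_mul_of_nonneg_left hu.2 ht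

/-! ### Reflection to the nonnegative orthant -/

section SignVector

variable {d : ℕ} {J : Fin d → ℝ}

lemma sign_mul_sign_mul (hJ : ∀ i, J i = -1 ∨ J i = 1) (x : Fin d → ℝ) : J * (J * x) = x := by
  ext i
  rcases hJ i with h | h <;> simp [h]

/-- The part of the Count ball in the orthant of `J`, up to the reflection `x ↦ J * x`. -/
lemma sign_mul_mem_countBallInOrthant {k : ℕ} (hk : 1 ≤ k) [DecidablePred fun i => J i = 1]
    (hJ : ∀ i, J i = -1 ∨ J i = 1) (v : Fin d → ℝ) :
    J * v ∈ countBallInOrthant k J ↔ blockNorm (fun i => J i = 1) k v ≤ 1 ∧ 0 ≤ v := by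
  have horth : J * v ∈ orthant J ↔ 0 ≤ v := by
    constructor
    · rintro ⟨w, hw, h⟩
      rw [← sign_mul_sign_mul hJ v, h, sign_mul_sign_mul hJ w]
      exact hw
    · exact fun h => ⟨v, h, rfl⟩
  unfold countBallInOrthant
  rw [Set.mem_inter_iff, horth]
  refine and_congr_left fun hv => ?_
  rw [mem_countBall]
  constructor
  · rintro ⟨u, hu, w, hw, a, b, ha, hb, hab, h⟩
    have hi : ∀ i, J i * v i = a * u i - b * w i := fun i => congrFun h i
    refine le_of_le_of_eq ?_ hab
    refine add_le_add (countNorm_le_of_le_mul hk _ ha hv hu fun i hJi => ?_)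
      (countNorm_le_of_le_mul hk _ hb hv hw fun i hJi => ?_)
    · have := hi i
      rw [hJi] at this
      have := mul_nonneg hb (hw.1 i).1
      linarith
    · have := hi i
      rw [(hJ i).resolve_right hJi] at this
      have := mul_nonneg ha (hu.1 i).1
      linarith
  · intro h
    have hs := countNorm_nonneg (k := k) fun i : {i // J i = 1} => v i
    have ht := countNorm_nonneg (k := k) fun i : {i // ¬J i = 1} => v i
    -- The second weight is $1-N(v_+)$ rather than $N(v_-)$, so that the weights sum to exactly 1.
    have hle : countNorm k (fun i : {i // ¬J i = 1} => v i) ≤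
        1 - countNorm k fun i : {i // J i = 1} => v i := by
      unfold blockNorm at h
      linarith
    obtain ⟨u, hu, hu'⟩ := exists_smul_eq_of_countNorm_le hk (fun i => J i = 1) hs hv le_rfl
    obtain ⟨w, hw, hw'⟩ := exists_smul_eq_of_countNorm_le hk (fun i => ¬J i = 1)
      (ht.trans hle) hv hle
    refine ⟨u, hu, w, hw, _, _, hs, ht.trans hle, add_sub_cancel _ _, ?_⟩
    ext i
    simp only [Pi.mul_apply, Pi.sub_apply, Pi.smul_apply, smul_eq_mul, hu', hw']
    rcases hJ i with h | h
    · norm_num [h]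
    · norm_num [h]

lemma measurePreserving_sign_mul (hJ : ∀ i, J i = -1 ∨ J i = 1) :
    MeasurePreserving (fun x : Fin d → ℝ => J * x) volume volume := by
  refine volume_preserving_pi (f := fun i x => J i * x) fun i => ?_
  rcases hJ i with h | h
  · simpa [h] using Measure.measurePreserving_neg (volume : Measure ℝ)
  · simp only [h, one_mul]
    exact MeasurePreserving.id (volume : Measure ℝ)

lemma volume_countBallInOrthant {k : ℕ} (hk : 1 ≤ k) [DecidablePred fun i => J i = 1]
    (hJ : ∀ i, J i = -1 ∨ J i = 1) :
    volume (countBallInOrthant k J) =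
      orthantMeasure (Fin d) {x | blockNorm (fun i => J i = 1) k x ≤ 1} := by
  have hb : MeasurableSet {x : Fin d → ℝ | blockNorm (fun i => J i = 1) k x ≤ 1} :=
    measurableSet_le ((measurable_countNorm.comp (by fun_prop)).add
      (measurable_countNorm.comp (by fun_prop))) measurable_const
  rw [Measure.restrict_apply hb, ← (measurePreserving_sign_mul hJ).measure_preimage
    (hb.inter measurableSet_Ici).nullMeasurableSet]
  congr 1
  ext x
  conv_lhs => rw [← sign_mul_sign_mul hJ x]
  exact sign_mul_mem_countBallInOrthant hk hJ (J * x)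

lemma volume_countBallInOrthant_zero (hd : 1 ≤ d) : volume (countBallInOrthant 0 J) = 0 := by
  have h0 : ∀ u ∈ countPositivePart d 0, u = 0 := by
    rintro u ⟨_, hu⟩
    ext i
    have := (Finset.sum_eq_zero_iff_of_nonneg fun i _ => abs_nonneg (u i)).1
      (le_antisymm (by simpa using hu) (Finset.sum_nonneg fun i _ => abs_nonneg (u i))) i
      (Finset.mem_univ i)
    simpa using this
  have hsub : countBallInOrthant 0 J ⊆ {0} := by
    rintro x ⟨hx, _⟩
    obtain ⟨u, hu, w, hw, a, b, -, -, -, rfl⟩ := mem_countBall.1 hx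
    simp [h0 u hu, h0 w hw]
  have : Nonempty (Fin d) := ⟨⟨0, hd⟩⟩
  exact measure_mono_null hsub (measure_singleton 0)

end SignVector

theorem mainTheorem4 (d k : ℕ) (hd : 1 ≤ d) (J : Fin d → ℝ) (hJ : ∀ i, J i = -1 ∨ J i = 1)
    (j : ℕ) (hj : {i : Fin d | J i = 1}.ncard = j) :
    MeasureTheory.volume (countBallInOrthant k J) =
      ENNReal.ofReal
        ((∑ i ∈ Finset.Icc 1 k, (eulerianNumber j (i - 1) : ℝ)) *
          (∑ i ∈ Finset.Icc 1 k, (eulerianNumber (d - j) (i - 1) : ℝ)) *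
          (1 / (Nat.factorial d : ℝ))) := by
  classical
  -- For $k=0$ the ball is a point, whereas division by zero would turn `countNorm` into the sup
  -- norm.
  rcases Nat.eq_zero_or_pos k with rfl | hk
  · simp [volume_countBallInOrthant_zero hd]
  have hcard : Fintype.card {i // J i = 1} = j := by
    rw [← hj, ← Nat.card_eq_fintype_card]
    rfl
  have hcard' : Fintype.card {i // ¬J i = 1} = d - j := by
    rw [Fintype.card_subtype_compl, hcard, Fintype.card_fin]
  have h := factorial_mul_orthantMeasure_blockNorm (fun i => J i = 1) k
  rw [← volume_countBallInOrthant hk hJ, factorial_mul_orthantMeasure_countNorm _ hk,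
    factorial_mul_orthantMeasure_countNorm _ hk, hcard, hcard', Fintype.card_fin,
    ← Nat.cast_mul] at h
  have hf : (d.factorial : ENNReal) ≠ 0 := by exact_mod_cast d.factorial_ne_zero
  rw [mul_one_div, ENNReal.ofReal_div_of_pos (by positivity), ENNReal.ofReal_natCast,
    ENNReal.eq_div_iff hf (ENNReal.natCast_ne_top _), h, ← ENNReal.ofReal_natCast]
  push_cast
  rfl
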